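/- Let $\mathcal X$ be a set of datasets with a symmetric neighbouring relation $\sim$. A mechanism $M$ on $\mathcal X$ with outcomes in a measurable space $Y$ assigns to every $x\in\mathcal X$ the probability law of an outcome $M(x)\in Y$. It is $(\varepsilon,\delta)$-DP if $\Pr[M(x)\in S]\le e^{\varepsilon}\Pr[M(x')\in S]+\delta$ for all $x\sim x'$ and all measurable $S\subseteq Y$, and $\varepsilon$-DP if it is $(\varepsilon,0)$-DP. It is $\varepsilon$-bounded range ($\varepsilon$-BR) if for all $x\sim x'$ and all measurable $S_1,S_2\subseteq Y$ $$\Pr[M(x)\in S_1]\,\Pr[M(x')\in S_2]\le e^{\varepsilon}\,\Pr[M(x)\in S_2]\,\Pr[M(x')\in S_1];$$ for discrete $Y$ this means that $\frac{\Pr[M(x)=y_1]}{\Pr[M(x')=y_1]}\le e^{\varepsilon}\frac{\Pr[M(x)=y_2]}{\Pr[M(x')=y_2]}$ for all $y_1,y_2\in Y$. Let $\mathcal M_{\mathrm{DP}}(\varepsilon)$ and $\mathcal M_{\mathrm{BR}}(\varepsilon)$ be the classes of all $\varepsilon$-DP and of all $\varepsilon$-BR mechanisms. For classes $\mathcal A_1,\dots,\mathcal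 A_N$ of mechanisms, let $(\mathcal A_1,\dots,\mathcal A_N)$ be the class of their adaptive compositions: on the dataset $x$ one runs successively $M_1(x)$, $M_2(x,y_1)$, \dots, $M_N(x,y_1,\dots,y_{N-1})$, where $y_i$ is the outcome of the $i$-th run, and outputs $(y_1,\dots,y_N)$; here the law of $M_i(x,y_1,\dots,y_{i-1})$ depends measurably on $(y_1,\dots,y_{i-1})$ and $M_i(\cdot,y_1,\dots,y_{i-1})\in\mathcal A_i$ for all $y_1,\dots,y_{i-1}$. For $\varepsilon_g\in\mathbb R$, a mechanism $M$ and a class $\mathcal M$ put $$\delta_{\mathrm{opt}}(M;\varepsilon_g)=\inf\{\delta\ge 0: M\text{ is }(\varepsilon_g,\delta)\text{-DP}\},\qquad \delta_{\mathrm{opt}}(\mathcal M;\varepsilon_g)=\sup_{M\in\mathcal M}\delta_{\mathrm{opt}}(M;\varepsilon_g).$$ **Proposition.** Let $\varepsilon>0$ and $N\in\mathbb N$, and let $\mathcal A_1,\dots,\mathcal A_N$ and $\mathcal B_1,\dots,\mathcal B_N$ be such that, for some $k_{\mathcal A},k_{\mathcal B}\in\{1,\dots,N\}$, $\mathcal A_{k_{\mathcal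 A}}=\mathcal B_{k_{\mathcal B}}=\mathcal M_{\mathrm{BR}}(\varepsilon)$, while $\mathcal A_i=\mathcal M_{\mathrm{DP}}(\varepsilon)$ for all $i\ne k_{\mathcal A}$ and $\mathcal B_j=\mathcal M_{\mathrm{DP}}(\varepsilon)$ for all $j\ne k_{\mathcal B}$. Then for every $\varepsilon_g\in\mathbb R$ $$\delta_{\mathrm{opt}}\big((\mathcal A_1,\dots,\mathcal A_N);\varepsilon_g\big)=\delta_{\mathrm{opt}}\big((\mathcal B_1,\dots,\mathcal B_N);\varepsilon_g\big).$$ -/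

import Mathlib

open MeasureTheory ProbabilityTheory

universe u v

/-- A randomized algorithm from datasets `𝒳` to outcomes `Y`: it sends each dataset to the law
of its outcome. -/
abbrev Mechanism (𝒳 : Type u) (Y : Type v) [MeasurableSpace Y] : Type (max u v) :=
  𝒳 → ProbabilityMeasure Y

/-- A class of mechanisms on the datasets `𝒳`, with arbitrary measurable outcome spaces. -/
abbrev MechClass (𝒳 : Type u) : Type (max u (v + 1)) :=
  (Y : Type v) → [MeasurableSpace Y] → Set (Mechanism 𝒳 Y)

section Privacy

variable {𝒳 : Type u} (nbr : 𝒳 → 𝒳 → Prop)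

/-- `M` is `(ε, δ)`-differentially private for the neighbouring relation `nbr`. -/
def IsDP {Y : Type v} [MeasurableSpace Y] (M : Mechanism 𝒳 Y) (ε δ : ℝ) : Prop :=
  ∀ x x' : 𝒳, nbr x x' → ∀ S : Set Y, MeasurableSet S →
    (M x S : ℝ) ≤ Real.exp ε * (M x' S : ℝ) + δ

/-- `M` is `ε`-bounded range: for neighbours `x, x'`, any two values of the likelihood ratio of
`M x` to `M x'` differ by a factor of at most `exp ε`. The inequality
`P(S₁) / P'(S₁) ≤ exp ε * (P(S₂) / P'(S₂))` is written with the denominators cleared and for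
measurable events, so that it makes sense on outcome spaces where points have probability `0`;
when the outcome space is discrete it is equivalent to its restriction to one-point events. -/
def IsBR {Y : Type v} [MeasurableSpace Y] (M : Mechanism 𝒳 Y) (ε : ℝ) : Prop :=
  ∀ x x' : 𝒳, nbr x x' → ∀ S₁ S₂ : Set Y, MeasurableSet S₁ → MeasurableSet S₂ →
    (M x S₁ : ℝ) * (M x' S₂ : ℝ) ≤ Real.exp ε * ((M x S₂ : ℝ) * (M x' S₁ : ℝ))

/-- The class of all `ε`-DP mechanisms. -/
def classDP (ε : ℝ) : MechClass.{u, v} 𝒳 := fun _ _ => {M | IsDP nbr M ε 0}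

/-- The class of all `ε`-BR mechanisms. -/
def classBR (ε : ℝ) : MechClass.{u, v} 𝒳 := fun _ _ => {M | IsBR nbr M ε}

/-- `δ_opt(M; ε_g)`, the least `δ ≥ 0` for which `M` is `(ε_g, δ)`-DP (an infimum over a set that
contains `1` and is bounded below by `0`). -/
noncomputable def deltaOptMech {Y : Type v} [MeasurableSpace Y] (M : Mechanism 𝒳 Y) (εg : ℝ) : ℝ :=
  sInf {δ : ℝ | 0 ≤ δ ∧ IsDP nbr M εg δ}

/-- `δ_opt(𝓜; ε_g)`, the supremum of `δ_opt(M; ε_g)` over the mechanisms `M` of the class `𝓜`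
(all these numbers lie in `[0, 1]`). -/
noncomputable def deltaOpt (C : MechClass.{u, v} 𝒳) (εg : ℝ) : ℝ :=
  sSup {d : ℝ | ∃ (Y : Type v) (_ : MeasurableSpace Y), ∃ M ∈ C Y, d = deltaOptMech nbr M εg}

end Privacy

/-- The mechanism that is run when the history of earlier outcomes is `h`. -/
noncomputable def mechAt {𝒳 : Type u} {H Y : Type v} [MeasurableSpace H] [MeasurableSpace Y]
    (κ : 𝒳 → Kernel H Y) [∀ x, IsMarkovKernel (κ x)] (h : H) : Mechanism 𝒳 Y :=
  fun x => ⟨κ x h, inferInstance⟩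

/-- `IsAdaptiveRun Cs H R κ`: after a history in `H`, one runs one mechanism from each class of the
list `Cs`, in this order; each mechanism may depend (measurably) on the history and on all
outcomes obtained so far, and whatever these are it belongs to its class. `R` is the space of the
tuples of outcomes, and `κ x h` is the joint law of the outcomes on the dataset `x` after the
history `h`. -/
inductive IsAdaptiveRun {𝒳 : Type u} : List (MechClass.{u, v} 𝒳) →
    (H : Type v) → [MeasurableSpace H] → (R : Type v) → [MeasurableSpace R] →
    (𝒳 → Kernel H R) → Prop
  | nil (H : Type v) [MeasurableSpace H] :
      IsAdaptiveRun [] H PUnit.{v + 1} (fun _ => Kernel.const H (Measure.dirac PUnit.unit))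
  | cons (C : MechClass.{u, v} 𝒳) (Cs : List (MechClass.{u, v} 𝒳))
      (H Y R : Type v) [MeasurableSpace H] [MeasurableSpace Y] [MeasurableSpace R]
      (κ : 𝒳 → Kernel H Y) [∀ x, IsMarkovKernel (κ x)]
      (η : 𝒳 → Kernel (H × Y) R) [∀ x, IsMarkovKernel (η x)]
      (hκ : ∀ h : H, mechAt κ h ∈ C Y)
      (hη : IsAdaptiveRun Cs (H × Y) R η) :
      IsAdaptiveRun (C :: Cs) H (Y × R) (fun x => Kernel.compProd (κ x) (η x))

/-- `(𝓜₁, …, 𝓜ₖ)`: the class of the mechanisms that run adaptively selected mechanisms from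
`𝓜₁, …, 𝓜ₖ`, in this order, and output all the outcomes. -/
def adaptiveClass {𝒳 : Type u} (Cs : List (MechClass.{u, v} 𝒳)) : MechClass.{u, v} 𝒳 :=
  fun R _ => {M | ∃ κ : 𝒳 → Kernel PUnit.{v + 1} R,
    IsAdaptiveRun Cs PUnit.{v + 1} R κ ∧ ∀ x, (M x : Measure R) = κ x PUnit.unit}

/-! For neighbours with laws P, P', consider the profile r ↦ sup over S of r P(S) - P'(S); at r =
exp(-εg), multiplied by exp(εg), it is the `δ` required by this pair. Put c = exp ε. Placing a
mechanism with likelihood ratios in [lo, hi] before a run of profile at most F gives a profile at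
most `chord lo hi F`, and the binary randomized response with ratios lo, hi attains this bound. A DP
mechanism has ratios in [1/c, c]; a BR mechanism has ratios in [hi/c, hi] for some hi in [1, c].

The operators `chord lo hi` commute (`chord_commute`), so the position of the BR step would not
matter if hi were fixed. But hi may depend on the history. Commuting brings the BR operator next to
`hockey`, the profile of the empty run, and the DP steps evaluate the result only at points r
c^(n-2j), n being the number of DP steps. These form a progression of ratio c², while chords of
`hockey` depend on hi only inside (1/c, c), which contains at most one such point. Hence a single hi
is optimal at all of them (`exists_isMax_chord_hockey_progression`). Adaptivity therefore gains
nothing over a fixed product of randomized responses (`IsAdaptiveRun.exists_le_chord`), whose order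
is irrelevant (`profileAttains_one_br`). -/

/-! ### Chord operators and their commutation -/

/-- The value at `r` of the chord of `f` over `[r * lo, r * hi]`. -/
noncomputable def chord (lo hi : ℝ) (f : ℝ → ℝ) (r : ℝ) : ℝ :=
  ((1 - lo) * f (r * hi) + (hi - 1) * f (r * lo)) / (hi - lo)

/-- Each operator is a linear combination of rescalings of the argument, and rescalings commute. -/
theorem chord_commute (a b a' b' : ℝ) : Function.Commute (chord a b) (chord a' b') := by
  intro f
  funext r
  simp only [chord]
  rw [mul_right_comm r b b', mul_right_comm r b a', mul_right_comm r a b', mul_right_comm r a a']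
  ring

theorem chord_mono_at {lo hi : ℝ} (h : lo < hi) (h1 : lo ≤ 1) (h2 : 1 ≤ hi) {f g : ℝ → ℝ} {r : ℝ}
    (hlo : f (r * lo) ≤ g (r * lo)) (hhi : f (r * hi) ≤ g (r * hi)) :
    chord lo hi f r ≤ chord lo hi g r := by
  unfold chord
  have := sub_pos.2 h
  have h1' := sub_nonneg.2 h1
  have h2' := sub_nonneg.2 h2
  gcongr

/-- The operator on value functions that corresponds to one run of a mechanism whose likelihood
ratios lie between `1 / c` and `c`. -/
noncomputable abbrev dpStep (c : ℝ) : (ℝ → ℝ) → ℝ → ℝ := chord (1 / c) c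

theorem one_div_lt_self {c : ℝ} (hc : 1 < c) : 1 / c < c :=
  ((div_lt_one (by linarith)).2 hc).trans hc

theorem dpStep_mono_at {c : ℝ} (hc : 1 < c) {f g : ℝ → ℝ} {r : ℝ}
    (hlo : f (r * (1 / c)) ≤ g (r * (1 / c))) (hhi : f (r * c) ≤ g (r * c)) :
    dpStep c f r ≤ dpStep c g r :=
  chord_mono_at (one_div_lt_self hc) ((div_lt_one (by linarith)).2 hc).le hc.le hlo hhi

theorem dpStep_iterate_mono {c : ℝ} (hc : 1 < c) {f g : ℝ → ℝ} (h : ∀ r, 0 < r → f r ≤ g r)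
    (n : ℕ) : ∀ r, 0 < r → (dpStep c)^[n] f r ≤ (dpStep c)^[n] g r := by
  have hc0 : 0 < c := by linarith
  induction n with
  | zero => exact h
  | succ n ih =>
    intro r hr
    rw [Function.iterate_succ_apply', Function.iterate_succ_apply']
    exact dpStep_mono_at hc (ih _ (by positivity)) (ih _ (by positivity))

/-- A run of the operator `dpStep c` only looks at the points of a geometric progression of
ratio `c ^ 2`. -/
theorem dpStep_iterate_mono_of_progression {c : ℝ} (hc : 1 < c) {f g : ℝ → ℝ} (n : ℕ) {s : ℝ}
    (h : ∀ k : ℤ, f (s * c ^ (2 * k)) ≤ g (s * c ^ (2 * k))) (k : ℤ) :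
    (dpStep c)^[n] f (s * c ^ n * c ^ (2 * k)) ≤ (dpStep c)^[n] g (s * c ^ n * c ^ (2 * k)) := by
  have hc0 : c ≠ 0 := by linarith
  induction n generalizing k with
  | zero => simpa using h k
  | succ n ih =>
    rw [Function.iterate_succ_apply', Function.iterate_succ_apply']
    have e1 : s * c ^ (n + 1) * c ^ (2 * k) * (1 / c) = s * c ^ n * c ^ (2 * k) := by
      field_simp
      ring
    have e2 : s * c ^ (n + 1) * c ^ (2 * k) * c = s * c ^ n * c ^ (2 * (k + 1)) := by
      rw [mul_add, zpow_add₀ hc0, pow_succ, mul_one, zpow_ofNat]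
      ring
    apply dpStep_mono_at hc
    · rw [e1]; exact ih k
    · rw [e2]; exact ih (k + 1)

/-! ### Chords of the hockey-stick function -/

/-- The value function of the empty composition. -/
noncomputable def hockey (r : ℝ) : ℝ := max (r - 1) 0

/-- Convexity: the weights in `chord` make r the barycentre of r * lo and r * hi. -/
theorem hockey_le_chord {lo hi r : ℝ} (h : lo < hi) (h1 : lo ≤ 1) (h2 : 1 ≤ hi) :
    hockey r ≤ chord lo hi hockey r := by
  have hd := sub_pos.2 h
  have h1' := sub_nonneg.2 h1
  have h2' := sub_nonneg.2 h2
  unfold chord hockey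
  rw [le_div_iff₀ hd]
  rcases max_choice (r - 1) 0 with e | e <;> rw [e]
  · have a := mul_le_mul_of_nonneg_left (le_max_left (r * hi - 1) 0) h1'
    have b := mul_le_mul_of_nonneg_left (le_max_left (r * lo - 1) 0) h2'
    linarith
  · rw [zero_mul]
    positivity

/-- When the kink at 1 is not interior to [r * lo, r * hi], `hockey` is affine there and the chord
is exact. This is the case to the left of the kink; `chord_hockey_of_ge` is the case to the right.
-/
theorem chord_hockey_of_le {lo hi r : ℝ} (hr : 0 < r) (h : lo < hi) (hr' : r * hi ≤ 1) (h2 : 1 ≤ hi) :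
    chord lo hi hockey r = hockey r := by
  have a : r * lo ≤ r * hi := by gcongr
  have b : r ≤ r * hi := le_mul_of_one_le_right hr.le h2
  unfold chord hockey
  rw [max_eq_right (by linarith), max_eq_right (by linarith), max_eq_right (by linarith)]
  simp

theorem chord_hockey_of_ge {lo hi r : ℝ} (hr : 0 < r) (h : lo < hi) (hr' : 1 ≤ r * lo)
    (h1 : lo ≤ 1) : chord lo hi hockey r = hockey r := by
  have a : r * lo ≤ r * hi := by gcongr
  have b : r * lo ≤ r := mul_le_of_le_one_right hr.le h1
  have hd := sub_pos.2 h
  unfold chord hockey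
  rw [max_eq_left (by linarith), max_eq_left (by linarith), max_eq_left (by linarith)]
  field_simp
  ring

theorem exists_isMax_chord_hockey {c : ℝ} (hc : 1 < c) (r : ℝ) :
    ∃ hi ∈ Set.Icc 1 c, ∀ hi' ∈ Set.Icc 1 c,
      chord (hi' / c) hi' hockey r ≤ chord (hi / c) hi hockey r := by
  have hc0 : 0 < c := by linarith
  refine isCompact_Icc.exists_isMaxOn (f := fun hi => chord (hi / c) hi hockey r)
    ⟨1, by simp [hc.le]⟩ ?_
  unfold chord hockey
  refine ContinuousOn.div (by fun_prop) (by fun_prop) fun x hx => ?_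
  have : x / c < x := div_lt_self (by linarith [hx.1]) hc
  linarith

theorem div_lt_self_of_mem {c hi : ℝ} (hc : 1 < c) (h : hi ∈ Set.Icc 1 c) : hi / c < hi :=
  div_lt_self (by linarith [h.1]) hc

theorem div_le_one_of_mem {c hi : ℝ} (hc : 1 < c) (h : hi ∈ Set.Icc 1 c) : hi / c ≤ 1 :=
  (div_le_one (by linarith)).2 h.2

/-- One likelihood ratio `hi` is optimal at all points of a geometric progression of
ratio `c ^ 2`. -/
theorem exists_isMax_chord_hockey_progression {c : ℝ} (hc : 1 < c) {s : ℝ} (hs : 0 < s) :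
    ∃ hi ∈ Set.Icc 1 c, ∀ k : ℤ, ∀ hi' ∈ Set.Icc 1 c,
      chord (hi' / c) hi' hockey (s * c ^ (2 * k)) ≤
        chord (hi / c) hi hockey (s * c ^ (2 * k)) := by
  have hc0 : 0 < c := by linarith
  -- Outside (1/c, c) no admissible segment has the kink in its interior, so all choices of hi give
  -- the same value.
  have far : ∀ hi ∈ Set.Icc 1 c, ∀ hi' ∈ Set.Icc 1 c, ∀ r, 0 < r → (r * c ≤ 1 ∨ c ≤ r) →
      chord (hi' / c) hi' hockey r ≤ chord (hi / c) hi hockey r := by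
    intro hi h hi' h' r hr hfar
    refine le_trans (le_of_eq ?_) (hockey_le_chord (div_lt_self_of_mem hc h)
      (div_le_one_of_mem hc h) h.1)
    rcases hfar with hfar | hfar
    · refine chord_hockey_of_le hr (div_lt_self_of_mem hc h') (le_trans ?_ hfar) h'.1
      gcongr
      exact h'.2
    · refine chord_hockey_of_ge hr (div_lt_self_of_mem hc h') ?_ (div_le_one_of_mem hc h')
      rw [← mul_div_assoc, one_le_div hc0]
      nlinarith [h'.1]
  -- Consecutive points differ by the factor c², the ratio of the endpoints of (1/c, c), so at most
  -- one point is sensitive to hi; the optimum there serves all.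
  by_cases hk : ∃ k : ℤ, 1 < s * c ^ (2 * k) * c ∧ s * c ^ (2 * k) < c
  · obtain ⟨k, hk1, hk2⟩ := hk
    obtain ⟨hi, h, hmax⟩ := exists_isMax_chord_hockey hc (s * c ^ (2 * k))
    refine ⟨hi, h, fun j hi' h' => ?_⟩
    rcases lt_trichotomy j k with hj | rfl | hj
    · refine far hi h hi' h' _ (by positivity) (Or.inl ?_)
      have e : c ^ (2 * j) * c * c ≤ c ^ (2 * k) := by
        rw [← zpow_add_one₀ hc0.ne', ← zpow_add_one₀ hc0.ne']
        exact zpow_le_zpow_right₀ hc.le (by omega)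
      have : s * c ^ (2 * j) * c * c ≤ 1 * c :=
        calc s * c ^ (2 * j) * c * c = s * (c ^ (2 * j) * c * c) := by ring
          _ ≤ s * c ^ (2 * k) := by gcongr
          _ ≤ 1 * c := by linarith
      exact le_of_mul_le_mul_right this hc0
    · exact hmax hi' h'
    · refine far hi h hi' h' _ (by positivity) (Or.inr ?_)
      have e : c ^ (2 * k) * c * c ≤ c ^ (2 * j) := by
        rw [← zpow_add_one₀ hc0.ne', ← zpow_add_one₀ hc0.ne']
        exact zpow_le_zpow_right₀ hc.le (by omega)
      calc c ≤ s * c ^ (2 * k) * c * c := le_mul_of_one_le_left hc0.le hk1.le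
        _ = s * (c ^ (2 * k) * c * c) := by ring
        _ ≤ s * c ^ (2 * j) := by gcongr
  · push Not at hk
    have h1 : (1 : ℝ) ∈ Set.Icc 1 c := ⟨le_rfl, hc.le⟩
    -- No point is sensitive, so any hi would do.
    refine ⟨1, h1, fun k hi' h' => far 1 h1 hi' h' _ (by positivity) ?_⟩
    exact (le_or_gt (s * c ^ (2 * k) * c) 1).imp id (hk k)

/-! ### Upper bounds -/

section Integral

variable {Y : Type*} [MeasurableSpace Y] {P Q : Measure Y}

theorem integral_le_mul_integral_of_real_le [IsFiniteMeasure P] [IsFiniteMeasure Q] {a : ℝ}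
    (ha : 0 ≤ a)
    (h : ∀ S, MeasurableSet S → P.real S ≤ a * Q.real S) {f : Y → ℝ} (hf : Integrable f Q)
    (hf0 : ∀ y, 0 ≤ f y) : ∫ y, f y ∂P ≤ a * ∫ y, f y ∂Q := by
  have hle : P ≤ ENNReal.ofReal a • Q := by
    refine Measure.le_iff.2 fun S hS => ?_
    rw [Measure.smul_apply, smul_eq_mul, ← ofReal_measureReal (μ := Q),
      ← ENNReal.ofReal_mul ha, ← ofReal_measureReal (μ := P)]
    exact ENNReal.ofReal_le_ofReal (h S hS)
  refine (integral_mono_measure hle (ae_of_all _ hf0)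
    (hf.smul_measure ENNReal.ofReal_ne_top)).trans (le_of_eq ?_)
  rw [integral_smul_measure, ENNReal.toReal_ofReal ha, smul_eq_mul]

/-- No density is needed: F(r hi) - (r hi φ - ψ) and F(r lo) - (r lo φ - ψ) are nonnegative.
Integrating the first with lo Q ≤ P and the second with P ≤ hi Q, then adding, cancels ∫φ dQ and ∫ψ
dP. -/
theorem mul_integral_sub_integral_le_chord [IsProbabilityMeasure P] [IsProbabilityMeasure Q]
    {lo hi r : ℝ} (hlo : 0 < lo) (h : lo < hi)
    (hP : ∀ S, MeasurableSet S → P.real S ≤ hi * Q.real S)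
    (hQ : ∀ S, MeasurableSet S → lo * Q.real S ≤ P.real S)
    {φ ψ : Y → ℝ} (hφ : ∀ μ : Measure Y, IsProbabilityMeasure μ → Integrable φ μ)
    (hψ : ∀ μ : Measure Y, IsProbabilityMeasure μ → Integrable ψ μ) {F : ℝ → ℝ}
    (hFhi : ∀ y, r * hi * φ y - ψ y ≤ F (r * hi)) (hFlo : ∀ y, r * lo * φ y - ψ y ≤ F (r * lo)) :
    r * ∫ y, φ y ∂P - ∫ y, ψ y ∂Q ≤ chord lo hi F r := by
  have int : ∀ a b : ℝ, ∀ μ : Measure Y, IsProbabilityMeasure μ →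
      Integrable (fun y => b - (a * φ y - ψ y)) μ := fun a b μ hμ =>
    (integrable_const b).sub (((hφ μ hμ).const_mul a).sub (hψ μ hμ))
  have eval : ∀ a b : ℝ, ∀ μ : Measure Y, IsProbabilityMeasure μ →
      ∫ y, (b - (a * φ y - ψ y)) ∂μ = b - (a * ∫ y, φ y ∂μ - ∫ y, ψ y ∂μ) := fun a b μ hμ => by
    have hsub : Integrable (fun y => a * φ y - ψ y) μ := ((hφ μ hμ).const_mul a).sub (hψ μ hμ)
    rw [integral_sub (integrable_const b) hsub, integral_sub ((hφ μ hμ).const_mul a) (hψ μ hμ), integral_const_mul]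
    simp
  have h1 := integral_le_mul_integral_of_real_le (P := Q) (Q := P) (a := 1 / lo)
    (by positivity) (fun S hS => by
      rw [one_div, ← div_eq_inv_mul, le_div_iff₀ hlo, mul_comm]; exact hQ S hS)
    (int (r * hi) (F (r * hi)) P inferInstance) (fun y => sub_nonneg.2 (hFhi y))
  have h2 := integral_le_mul_integral_of_real_le (P := P) (Q := Q) (hlo.trans h).le hP
    (int (r * lo) (F (r * lo)) Q inferInstance) (fun y => sub_nonneg.2 (hFlo y))
  rw [eval _ _ P inferInstance, eval _ _ Q inferInstance] at h1 h2
  rw [one_div, ← div_eq_inv_mul, le_div_iff₀ hlo] at h1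
  unfold chord
  rw [le_div_iff₀ (sub_pos.2 h)]
  linarith

/-- Take for hi the supremum of P(S)/Q(S) over events with Q(S) > 0. The whole space gives hi ≥ 1,
bounded range against the whole space gives hi ≤ c, and bounded range against an arbitrary event
gives the lower ratio hi/c. -/
theorem exists_ratio_bounds_of_bounded_range [IsProbabilityMeasure P] [IsProbabilityMeasure Q]
    {c : ℝ} (hc : 1 < c) (h : ∀ S₁ S₂, MeasurableSet S₁ → MeasurableSet S₂ →
      P.real S₁ * Q.real S₂ ≤ c * (P.real S₂ * Q.real S₁)) :
    ∃ hi ∈ Set.Icc 1 c, (∀ S, MeasurableSet S → P.real S ≤ hi * Q.real S) ∧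
      ∀ S, MeasurableSet S → hi / c * Q.real S ≤ P.real S := by
  have hc0 : 0 < c := by linarith
  have hle : ∀ S, MeasurableSet S → P.real S ≤ c * Q.real S := fun S hS => by
    simpa using h S Set.univ hS .univ
  set A : Set ℝ := {t | ∃ S, MeasurableSet S ∧ 0 < Q.real S ∧ t = P.real S / Q.real S} with hA
  have hbd : ∀ t ∈ A, t ≤ c := by
    rintro t ⟨S, hS, hpos, rfl⟩
    exact (div_le_iff₀ hpos).2 (hle S hS)
  have h1 : (1 : ℝ) ∈ A := ⟨Set.univ, .univ, by simp, by simp⟩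
  refine ⟨sSup A, ⟨le_csSup ⟨c, hbd⟩ h1, csSup_le ⟨1, h1⟩ hbd⟩, fun S hS => ?_, fun S hS => ?_⟩
  · rcases (measureReal_nonneg (μ := Q) (s := S)).eq_or_lt with h0 | hpos
    · simpa [← h0] using hle S hS
    · exact (div_le_iff₀ hpos).1 (le_csSup ⟨c, hbd⟩ ⟨S, hS, hpos, rfl⟩)
  · rcases (measureReal_nonneg (μ := Q) (s := S)).eq_or_lt with h0 | hpos
    · simp [← h0]
    · rw [← le_div_iff₀ hpos, div_le_iff₀ hc0]
      refine csSup_le ⟨1, h1⟩ ?_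
      rintro t ⟨S', hS', hpos', rfl⟩
      rw [div_le_iff₀ hpos', div_mul_eq_mul_div, div_mul_eq_mul_div, le_div_iff₀ hpos]
      linarith [h S' S hS' hS]

end Integral

theorem compProd_real_apply {H Y R : Type*} [MeasurableSpace H] [MeasurableSpace Y]
    [MeasurableSpace R] (κ : Kernel H Y) [IsMarkovKernel κ] (η : Kernel (H × Y) R)
    [IsMarkovKernel η] (h : H) {S : Set (Y × R)} (hS : MeasurableSet S) :
    (Kernel.compProd κ η h).real S = ∫ y, (η (h, y)).real (Prod.mk y ⁻¹' S) ∂κ h := by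
  rw [measureReal_def, Kernel.compProd_apply hS, ← integral_toReal]
  · rfl
  · exact (Kernel.measurable_kernel_prodMk_left' hS h).aemeasurable
  · exact ae_of_all _ fun y => measure_lt_top _ _

theorem integrable_kernel_section {H Y R : Type*} [MeasurableSpace H] [MeasurableSpace Y]
    [MeasurableSpace R] (η : Kernel (H × Y) R) [IsMarkovKernel η] (h : H) {S : Set (Y × R)}
    (hS : MeasurableSet S) (μ : Measure Y) [IsProbabilityMeasure μ] :
    Integrable (fun y => (η (h, y)).real (Prod.mk y ⁻¹' S)) μ := by
  refine Integrable.of_bound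
    (Kernel.measurable_kernel_prodMk_left' hS h).ennreal_toReal.aestronglyMeasurable 1
    (ae_of_all _ fun y => ?_)
  rw [Real.norm_of_nonneg measureReal_nonneg]
  exact measureReal_le_one

theorem IsAdaptiveRun.isMarkovKernel {𝒳 : Type u} {Cs : List (MechClass.{u, v} 𝒳)} {H R : Type v}
    [MeasurableSpace H] [MeasurableSpace R] {κ : 𝒳 → Kernel H R} (h : IsAdaptiveRun Cs H R κ)
    (x : 𝒳) : IsMarkovKernel (κ x) := by
  cases h <;> infer_instance

/-- The privacy profile of the pair of families of laws `κ, κ'` is at most `F`. -/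
def ProfileLE {H R : Type v} [MeasurableSpace H] [MeasurableSpace R] (κ κ' : Kernel H R)
    (F : ℝ → ℝ) : Prop :=
  ∀ r : ℝ, 0 < r → ∀ (h : H) (S : Set R), MeasurableSet S →
    r * (κ h).real S - (κ' h).real S ≤ F r

section Upper

variable {𝒳 : Type u} {nbr : 𝒳 → 𝒳 → Prop}

/-- Adaptivity is absorbed here: `ProfileLE` bounds the continuation uniformly over histories, so
the same F applies after every outcome y. -/
theorem profileLE_compProd_of_ratio {H Y R : Type v} [MeasurableSpace H] [MeasurableSpace Y]
    [MeasurableSpace R] {κ κ' : Kernel H Y} [IsMarkovKernel κ] [IsMarkovKernel κ']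
    {η η' : Kernel (H × Y) R} [IsMarkovKernel η] [IsMarkovKernel η'] {F : ℝ → ℝ}
    (hη : ProfileLE η η' F) {h : H} {lo hi r : ℝ} (hr : 0 < r) (hlo : 0 < lo) (hlt : lo < hi)
    (hP : ∀ S, MeasurableSet S → (κ h).real S ≤ hi * (κ' h).real S)
    (hQ : ∀ S, MeasurableSet S → lo * (κ' h).real S ≤ (κ h).real S)
    {S : Set (Y × R)} (hS : MeasurableSet S) :
    r * (Kernel.compProd κ η h).real S - (Kernel.compProd κ' η' h).real S ≤ chord lo hi F r := by
  rw [compProd_real_apply κ η h hS, compProd_real_apply κ' η' h hS]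
  have hhi := hlo.trans hlt
  exact mul_integral_sub_integral_le_chord hlo hlt hP hQ
    (fun μ _ => integrable_kernel_section η h hS μ)
    (fun μ _ => integrable_kernel_section η' h hS μ)
    (fun y => hη _ (by positivity) (h, y) _ (measurable_prodMk_left hS))
    (fun y => hη _ (by positivity) (h, y) _ (measurable_prodMk_left hS))

theorem profileLE_compProd_dp (hnbr : ∀ x x', nbr x x' → nbr x' x) {ε : ℝ} (hε : 0 < ε)
    {x x' : 𝒳} (hx : nbr x x') {H Y R : Type v} [MeasurableSpace H] [MeasurableSpace Y]
    [MeasurableSpace R] {κ : 𝒳 → Kernel H Y} [∀ x, IsMarkovKernel (κ x)]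
    {η : 𝒳 → Kernel (H × Y) R} [∀ x, IsMarkovKernel (η x)] {F : ℝ → ℝ}
    (hκ : ∀ h, IsDP nbr (mechAt κ h) ε 0) (hη : ProfileLE (η x) (η x') F) :
    ProfileLE (Kernel.compProd (κ x) (η x)) (Kernel.compProd (κ x') (η x'))
      (dpStep (Real.exp ε) F) := by
  intro r hr h S hS
  have hc := Real.exp_pos ε
  refine profileLE_compProd_of_ratio hη hr (by positivity)
    (one_div_lt_self (Real.one_lt_exp_iff.2 hε)) (fun T hT => ?_) (fun T hT => ?_) hS
  · have := hκ h x x' hx T hT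
    rw [add_zero] at this
    exact this
  · have := hκ h x' x (hnbr _ _ hx) T hT
    rw [add_zero] at this
    rw [one_div, ← div_eq_inv_mul, div_le_iff₀ hc, mul_comm]
    exact this

theorem profileLE_compProd_br {ε : ℝ} (hε : 0 < ε)
    {x x' : 𝒳} (hx : nbr x x') {H Y R : Type v} [MeasurableSpace H] [MeasurableSpace Y]
    [MeasurableSpace R] {κ : 𝒳 → Kernel H Y} [∀ x, IsMarkovKernel (κ x)]
    {η : 𝒳 → Kernel (H × Y) R} [∀ x, IsMarkovKernel (η x)] {F G : ℝ → ℝ}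
    (hκ : ∀ h, IsBR nbr (mechAt κ h) ε) (hη : ProfileLE (η x) (η x') F)
    (hG : ∀ r, 0 < r → ∀ hi ∈ Set.Icc 1 (Real.exp ε), chord (hi / Real.exp ε) hi F r ≤ G r) :
    ProfileLE (Kernel.compProd (κ x) (η x)) (Kernel.compProd (κ x') (η x')) G := by
  intro r hr h S hS
  have hc := Real.one_lt_exp_iff.2 hε
  obtain ⟨hi, hhi, h1, h2⟩ := exists_ratio_bounds_of_bounded_range (P := κ x h) (Q := κ x' h) hc
    (fun S₁ S₂ hS₁ hS₂ => hκ h x x' hx S₁ S₂ hS₁ hS₂)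
  have : 0 < hi := by linarith [hhi.1]
  exact (profileLE_compProd_of_ratio hη hr (by positivity) (div_lt_self_of_mem hc hhi) h1 h2
    hS).trans (hG r hr hi hhi)

/-- Both claims go through one induction, as the pure DP claim supplies the continuation once the BR
step is reached. The function g dominates the BR chords of `hockey` for all hi at once, which allows
hi to vary with the history. -/
theorem IsAdaptiveRun.profileLE_aux (hnbr : ∀ x x', nbr x x' → nbr x' x) {ε : ℝ} (hε : 0 < ε)
    {x x' : 𝒳} (hx : nbr x x') {g : ℝ → ℝ}
    (hg : ∀ r, 0 < r → ∀ hi ∈ Set.Icc 1 (Real.exp ε), chord (hi / Real.exp ε) hi hockey r ≤ g r)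
    {Cs : List (MechClass.{u, v} 𝒳)} {H R : Type v} [MeasurableSpace H] [MeasurableSpace R]
    {κ : 𝒳 → Kernel H R} (hrun : IsAdaptiveRun Cs H R κ) :
    (∀ m, Cs = List.replicate m (classDP nbr ε) →
      ProfileLE (κ x) (κ x') ((dpStep (Real.exp ε))^[m] hockey)) ∧
    ∀ i m, Cs = List.replicate i (classDP nbr ε) ++
        classBR nbr ε :: List.replicate m (classDP nbr ε) →
      ProfileLE (κ x) (κ x') ((dpStep (Real.exp ε))^[i + m] g) := by
  induction hrun with
  | nil H =>
    refine ⟨fun m hm => ?_, fun i m hm => by simp at hm⟩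
    obtain rfl : m = 0 := by simpa using hm.symm
    intro r hr h S hS
    have h0 : 0 ≤ (Measure.dirac PUnit.unit : Measure PUnit).real S := measureReal_nonneg
    have h1 : (Measure.dirac PUnit.unit : Measure PUnit).real S ≤ 1 := measureReal_le_one
    simp only [Kernel.const_apply, Function.iterate_zero, id, hockey]
    rcases le_total r 1 with hr1 | hr1
    · exact le_max_of_le_right (by nlinarith)
    · exact le_max_of_le_left (by nlinarith)
  | cons C Cs H Y R κ η hκ hη ih =>
    refine ⟨fun m hm => ?_, fun i m hm => ?_⟩
    · cases m with
      | zero => simp at hm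
      | succ m =>
        rw [List.replicate_succ, List.cons.injEq] at hm
        obtain ⟨rfl, hm⟩ := hm
        rw [Function.iterate_succ_apply']
        exact profileLE_compProd_dp hnbr hε hx hκ (ih.1 m hm)
    · cases i with
      | zero =>
        rw [List.replicate_zero, List.nil_append, List.cons.injEq] at hm
        obtain ⟨rfl, hm⟩ := hm
        refine profileLE_compProd_br hε hx hκ (ih.1 m hm) fun r hr hi hhi => ?_
        -- The BR operator is moved inside the m DP operators to act on `hockey`, the only function
        -- for which `hg` controls it.
        rw [← ((chord_commute _ _ _ _).iterate_left m).eq]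
        rw [zero_add]
        exact dpStep_iterate_mono (Real.one_lt_exp_iff.2 hε) (fun s hs => hg s hs hi hhi) m r hr
      | succ i =>
        rw [List.replicate_succ, List.cons_append, List.cons.injEq] at hm
        obtain ⟨rfl, hm⟩ := hm
        rw [Nat.succ_add, Function.iterate_succ_apply']
        exact profileLE_compProd_dp hnbr hε hx hκ (ih.2 i m hm)

/-- On neighbouring datasets, a composition of `ε`-DP mechanisms and one `ε`-BR mechanism is at
most as distinguishable as some composition of binary randomized responses. -/
theorem IsAdaptiveRun.exists_le_chord (hnbr : ∀ x x', nbr x x' → nbr x' x) {ε : ℝ} (hε : 0 < ε)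
    {x x' : 𝒳} (hx : nbr x x') {i m : ℕ} {H R : Type v} [MeasurableSpace H] [MeasurableSpace R]
    {κ : 𝒳 → Kernel H R} (hrun : IsAdaptiveRun (List.replicate i (classDP nbr ε) ++
        classBR nbr ε :: List.replicate m (classDP nbr ε)) H R κ) {r : ℝ} (hr : 0 < r) :
    ∃ hi ∈ Set.Icc 1 (Real.exp ε), ∀ (h : H) (S : Set R), MeasurableSet S →
      r * (κ x h).real S - (κ x' h).real S ≤
        (dpStep (Real.exp ε))^[i + m] (chord (hi / Real.exp ε) hi hockey) r := by
  have hc := Real.one_lt_exp_iff.2 hε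
  choose o ho hmax using exists_isMax_chord_hockey hc
  set g : ℝ → ℝ := fun r => chord (o r / Real.exp ε) (o r) hockey r with hg
  -- The smallest point reached from r by i + m DP steps; it is the base of the progression.
  have hs : 0 < r / Real.exp ε ^ (i + m) := by positivity
  obtain ⟨hi, hhi, hprog⟩ := exists_isMax_chord_hockey_progression hc hs
  refine ⟨hi, hhi, fun h S hS => ?_⟩
  refine ((hrun.profileLE_aux hnbr hε hx (g := g) fun r _ hi hhi => hmax r hi hhi).2 i m rfl
    r hr h S hS).trans ?_
  have key := dpStep_iterate_mono_of_progression hc (f := g) (i + m)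
    (fun k => hprog k _ (ho _)) 0
  have e : r / Real.exp ε ^ (i + m) * Real.exp ε ^ (i + m) * Real.exp ε ^ (2 * (0 : ℤ)) = r := by
    field_simp
    simp
  rwa [e] at key

end Upper

/-! ### Randomized responses -/

/-- The law of a bit that is true with probability `p`. -/
noncomputable def bitLaw (p : ℝ) : Measure (ULift.{v} Bool) :=
  ENNReal.ofReal p • Measure.dirac ⟨true⟩ + ENNReal.ofReal (1 - p) • Measure.dirac ⟨false⟩

theorem isProbabilityMeasure_bitLaw {p : ℝ} (h0 : 0 ≤ p) (h1 : p ≤ 1) :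
    IsProbabilityMeasure (bitLaw.{v} p) := by
  refine ⟨?_⟩
  simp only [bitLaw, Measure.add_apply, Measure.smul_apply, measure_univ, smul_eq_mul, mul_one]
  rw [← ENNReal.ofReal_add h0 (by linarith)]
  simp

theorem integral_bitLaw {p : ℝ} (h0 : 0 ≤ p) (h1 : p ≤ 1) (f : ULift.{v} Bool → ℝ) :
    ∫ b, f b ∂bitLaw.{v} p = p * f ⟨true⟩ + (1 - p) * f ⟨false⟩ := by
  unfold bitLaw
  rw [integral_add_measure, integral_smul_measure, integral_smul_measure, integral_dirac,
    integral_dirac, ENNReal.toReal_ofReal h0, ENNReal.toReal_ofReal (by linarith)]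
  · rfl
  · exact (integrable_dirac (by simp)).smul_measure ENNReal.ofReal_ne_top
  · exact (integrable_dirac (by simp)).smul_measure ENNReal.ofReal_ne_top

theorem bitLaw_real {p : ℝ} (h0 : 0 ≤ p) (h1 : p ≤ 1) (S : Set (ULift.{v} Bool)) :
    (bitLaw.{v} p).real S = p * S.indicator 1 ⟨true⟩ + (1 - p) * S.indicator 1 ⟨false⟩ := by
  have : IsProbabilityMeasure (bitLaw.{v} p) := isProbabilityMeasure_bitLaw h0 h1
  rw [← integral_bitLaw h0 h1 (S.indicator 1), integral_indicator_one]
  exact MeasurableSet.of_discrete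

/-- The probability of `true` under the second law of the randomized response with likelihood
ratios `hi` (at `true`) and `lo` (at `false`). -/
noncomputable def responseProb (lo hi : ℝ) : ℝ := (1 - lo) / (hi - lo)

section Response

variable {lo hi : ℝ}

theorem responseProb_nonneg (h : lo < hi) (h1 : lo ≤ 1) : 0 ≤ responseProb lo hi :=
  div_nonneg (sub_nonneg.2 h1) (sub_pos.2 h).le

theorem responseProb_le_one (h : lo < hi) (h2 : 1 ≤ hi) : responseProb lo hi ≤ 1 :=
  (div_le_one (sub_pos.2 h)).2 (by linarith)

/-- `responseProb` is the weight q with q hi + (1 - q) lo = 1, so the two outcomes have likelihood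
ratios exactly hi and lo. -/
theorem one_sub_mul_responseProb (h : lo < hi) :
    1 - hi * responseProb lo hi = lo * (1 - responseProb lo hi) := by
  have := (sub_pos.2 h).ne'
  unfold responseProb
  field_simp
  ring

theorem mul_responseProb_le_one (h0 : 0 ≤ lo) (h : lo < hi) (h2 : 1 ≤ hi) :
    hi * responseProb lo hi ≤ 1 := by
  have := mul_nonneg h0 (sub_nonneg.2 (responseProb_le_one h h2))
  linarith [one_sub_mul_responseProb h]

theorem bitLaw_response_le (h0 : 0 ≤ lo) (h : lo < hi) (h1 : lo ≤ 1) (h2 : 1 ≤ hi)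
    (S : Set (ULift.{v} Bool)) :
    (bitLaw.{v} (hi * responseProb lo hi)).real S ≤
        hi * (bitLaw.{v} (responseProb lo hi)).real S ∧
      lo * (bitLaw.{v} (responseProb lo hi)).real S ≤
        (bitLaw.{v} (hi * responseProb lo hi)).real S := by
  have hq0 := responseProb_nonneg h h1
  have hq1 := responseProb_le_one h h2
  rw [bitLaw_real (by positivity) (mul_responseProb_le_one h0 h h2), bitLaw_real hq0 hq1,
    one_sub_mul_responseProb h]
  set q := responseProb lo hi
  have ht : 0 ≤ S.indicator (1 : ULift.{v} Bool → ℝ) ⟨true⟩ := Set.indicator_nonneg (by simp) _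
  have hf : 0 ≤ S.indicator (1 : ULift.{v} Bool → ℝ) ⟨false⟩ := Set.indicator_nonneg (by simp) _
  have a := mul_nonneg (sub_nonneg.2 h.le) (mul_nonneg hq0 ht)
  have b := mul_nonneg (sub_nonneg.2 h.le) (mul_nonneg (sub_nonneg.2 hq1) hf)
  constructor <;> linarith

/-- The randomized response that answers whether the dataset is marked, with likelihood ratios
`hi` and `lo`. -/
noncomputable def responseKernel {𝒳 : Type u} (b : 𝒳 → Bool) (lo hi : ℝ) (H : Type v)
    [MeasurableSpace H] (x : 𝒳) : Kernel H (ULift.{v} Bool) :=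
  Kernel.const H (bitLaw (if b x then hi * responseProb lo hi else responseProb lo hi))

variable {𝒳 : Type u} {b : 𝒳 → Bool} {H : Type v} [MeasurableSpace H]

theorem isMarkovKernel_responseKernel (h0 : 0 ≤ lo) (h : lo < hi) (h1 : lo ≤ 1) (h2 : 1 ≤ hi)
    (x : 𝒳) : IsMarkovKernel (responseKernel b lo hi H x) := by
  have hq0 := responseProb_nonneg h h1
  refine ⟨fun _ => ?_⟩
  rw [responseKernel, Kernel.const_apply]
  split_ifs
  · exact isProbabilityMeasure_bitLaw (by positivity) (mul_responseProb_le_one h0 h h2)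
  · exact isProbabilityMeasure_bitLaw hq0 (responseProb_le_one h h2)

theorem isDP_responseKernel (nbr : 𝒳 → 𝒳 → Prop) {ε : ℝ} (hε : 0 < ε)
    [∀ x, IsMarkovKernel (responseKernel b (1 / Real.exp ε) (Real.exp ε) H x)] (h : H) :
    IsDP nbr (mechAt (responseKernel b (1 / Real.exp ε) (Real.exp ε) H) h) ε 0 := by
  intro x x' _ S hS
  have hc := Real.one_lt_exp_iff.2 hε
  have hc0 := Real.exp_pos ε
  obtain ⟨k1, k2⟩ := bitLaw_response_le (lo := 1 / Real.exp ε) (by positivity)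
    (one_div_lt_self hc) ((div_lt_one hc0).2 hc).le hc.le S
  rw [one_div_mul_eq_div, div_le_iff₀ hc0, mul_comm _ (Real.exp ε)] at k2
  rw [add_zero]
  change (responseKernel b _ _ H x h).real S ≤ _ * (responseKernel b _ _ H x' h).real S
  simp only [responseKernel, Kernel.const_apply]
  split_ifs
  · exact le_mul_of_one_le_left measureReal_nonneg hc.le
  · exact k1
  · exact k2
  · exact le_mul_of_one_le_left measureReal_nonneg hc.le

theorem isBR_responseKernel (nbr : 𝒳 → 𝒳 → Prop) {ε : ℝ} (hε : 0 < ε)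
    (hhi : hi ∈ Set.Icc 1 (Real.exp ε))
    [∀ x, IsMarkovKernel (responseKernel b (hi / Real.exp ε) hi H x)] (h : H) :
    IsBR nbr (mechAt (responseKernel b (hi / Real.exp ε) hi H) h) ε := by
  intro x x' _ S₁ S₂ hS₁ hS₂
  have hc := Real.one_lt_exp_iff.2 hε
  have hc0 := Real.exp_pos ε
  have hi0 : 0 < hi := by linarith [hhi.1]
  -- All events have ratio between hi/c and hi, so two of these ratios differ by a factor of at most
  -- c.
  have k := bitLaw_response_le.{v} (lo := hi / Real.exp ε) (by positivity)
    (div_lt_self_of_mem hc hhi) (div_le_one_of_mem hc hhi) hhi.1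
  have main : ∀ S T : Set (ULift.{v} Bool),
      (bitLaw.{v} (hi * responseProb (hi / Real.exp ε) hi)).real S *
        (bitLaw.{v} (responseProb (hi / Real.exp ε) hi)).real T ≤
      Real.exp ε * ((bitLaw.{v} (hi * responseProb (hi / Real.exp ε) hi)).real T *
        (bitLaw.{v} (responseProb (hi / Real.exp ε) hi)).real S) := by
    intro S T
    have k2 := (k T).2
    rw [div_mul_eq_mul_div, div_le_iff₀ hc0] at k2
    calc _ ≤ hi * (bitLaw.{v} (responseProb (hi / Real.exp ε) hi)).real S *
          (bitLaw.{v} (responseProb (hi / Real.exp ε) hi)).real T :=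
          mul_le_mul_of_nonneg_right (k S).1 measureReal_nonneg
      _ = hi * (bitLaw.{v} (responseProb (hi / Real.exp ε) hi)).real T *
          (bitLaw.{v} (responseProb (hi / Real.exp ε) hi)).real S := by ring
      _ ≤ _ * Real.exp ε * (bitLaw.{v} (responseProb (hi / Real.exp ε) hi)).real S :=
          mul_le_mul_of_nonneg_right k2 measureReal_nonneg
      _ = _ := by ring
  change (responseKernel b _ _ H x h).real S₁ * (responseKernel b _ _ H x' h).real S₂ ≤
    _ * ((responseKernel b _ _ H x h).real S₂ * (responseKernel b _ _ H x' h).real S₁)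
  simp only [responseKernel, Kernel.const_apply]
  split_ifs
  · rw [mul_comm (Measure.real _ S₂)]
    exact le_mul_of_one_le_left (mul_nonneg measureReal_nonneg measureReal_nonneg) hc.le
  · exact main S₁ S₂
  · linarith [main S₂ S₁]
  · rw [mul_comm (Measure.real _ S₂)]
    exact le_mul_of_one_le_left (mul_nonneg measureReal_nonneg measureReal_nonneg) hc.le

end Response

/-- After every history there is a run of mechanisms from the classes `Cs` whose privacy profile
at marked and unmarked datasets is at least `F`. -/
def ProfileAttains {𝒳 : Type u} (b : 𝒳 → Bool) (Cs : List (MechClass.{u, v} 𝒳))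
    (F : ℝ → ℝ) : Prop :=
  ∀ (H : Type v) [MeasurableSpace H], ∃ (R : Type v) (_ : MeasurableSpace R)
    (κ : 𝒳 → Kernel H R), IsAdaptiveRun Cs H R κ ∧
      ∀ x x', b x = true → b x' = false → ∀ r : ℝ, 0 < r → ∀ h, ∃ S, MeasurableSet S ∧
        F r ≤ r * (κ x h).real S - (κ x' h).real S

section Lower

variable {𝒳 : Type u} {b : 𝒳 → Bool}

theorem profileAttains_nil : ProfileAttains.{u, v} b [] hockey := by
  intro H _
  refine ⟨_, _, _, IsAdaptiveRun.nil H, fun x x' _ _ r hr h => ?_⟩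
  rcases le_total r 1 with hr1 | hr1
  · exact ⟨∅, .empty, by simp [hockey, hr1]⟩
  · exact ⟨Set.univ, .univ, by simp [hockey, hr1]⟩

/-- The witness event joins an event good for F at r * hi after the answer true with one good for F
at r * lo after false; the weights of the two answers are those of the chord. -/
theorem profileAttains_cons {lo hi : ℝ} (h0 : 0 < lo) (h : lo < hi) (h1 : lo ≤ 1) (h2 : 1 ≤ hi)
    {C : MechClass.{u, v} 𝒳} {Cs : List (MechClass.{u, v} 𝒳)} {F : ℝ → ℝ}
    (hC : ∀ (H : Type v) [MeasurableSpace H]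
      [∀ x, IsMarkovKernel (responseKernel b lo hi H x)] (t : H),
      mechAt (responseKernel b lo hi H) t ∈ C (ULift.{v} Bool))
    (hCs : ProfileAttains b Cs F) : ProfileAttains b (C :: Cs) (chord lo hi F) := by
  intro H _
  have hMarkov : ∀ x, IsMarkovKernel (responseKernel b lo hi H x) :=
    isMarkovKernel_responseKernel h0.le h h1 h2
  obtain ⟨R, _, η, hη, hval⟩ := hCs (H × ULift.{v} Bool)
  have hMarkov' : ∀ x, IsMarkovKernel (η x) := hη.isMarkovKernel
  refine ⟨_, _, _, IsAdaptiveRun.cons C Cs H _ R (responseKernel b lo hi H) η (hC H) hη,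
    fun x x' hx hx' r hr t => ?_⟩
  have hi0 := h0.trans h
  obtain ⟨T, hT, hT'⟩ := hval x x' hx hx' (r * hi) (by positivity) (t, ⟨true⟩)
  obtain ⟨U, hU, hU'⟩ := hval x x' hx hx' (r * lo) (by positivity) (t, ⟨false⟩)
  have hS : MeasurableSet (({⟨true⟩} : Set (ULift.{v} Bool)) ×ˢ T ∪
      ({⟨false⟩} : Set (ULift.{v} Bool)) ×ˢ U) :=
    (MeasurableSet.of_discrete.prod hT).union (MeasurableSet.of_discrete.prod hU)
  refine ⟨_, hS, ?_⟩
  have hq0 := responseProb_nonneg h h1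
  have hq1 := responseProb_le_one h h2
  have et : Prod.mk (ULift.up true) ⁻¹' (({⟨true⟩} : Set (ULift.{v} Bool)) ×ˢ T ∪
      ({⟨false⟩} : Set (ULift.{v} Bool)) ×ˢ U) = T := by ext; simp
  have ef : Prod.mk (ULift.up false) ⁻¹' (({⟨true⟩} : Set (ULift.{v} Bool)) ×ˢ T ∪
      ({⟨false⟩} : Set (ULift.{v} Bool)) ×ˢ U) = U := by ext; simp
  rw [compProd_real_apply _ _ _ hS, compProd_real_apply _ _ _ hS]
  simp only [responseKernel, Kernel.const_apply, hx, hx', if_true, Bool.false_eq_true, if_false]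
  rw [integral_bitLaw (by positivity) (mul_responseProb_le_one h0.le h h2),
    integral_bitLaw hq0 hq1, et, ef, one_sub_mul_responseProb h]
  have e : chord lo hi F r =
      responseProb lo hi * F (r * hi) + (1 - responseProb lo hi) * F (r * lo) := by
    have := (sub_pos.2 h).ne'
    unfold chord responseProb
    field_simp
    ring
  rw [e]
  have k1 := mul_le_mul_of_nonneg_left hT' hq0
  have k2 := mul_le_mul_of_nonneg_left hU' (sub_nonneg.2 hq1)
  linarith

theorem profileAttains_replicate_append (nbr : 𝒳 → 𝒳 → Prop) {ε : ℝ} (hε : 0 < ε)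
    {Cs : List (MechClass.{u, v} 𝒳)} {F : ℝ → ℝ} (hCs : ProfileAttains b Cs F) (n : ℕ) :
    ProfileAttains b (List.replicate n (classDP nbr ε) ++ Cs)
      ((dpStep (Real.exp ε))^[n] F) := by
  have hc := Real.one_lt_exp_iff.2 hε
  have hc0 := Real.exp_pos ε
  induction n with
  | zero => exact hCs
  | succ n ih =>
    rw [List.replicate_succ, List.cons_append, Function.iterate_succ_apply']
    exact profileAttains_cons (by positivity) (one_div_lt_self hc) ((div_lt_one hc0).2 hc).le hc.le
      (fun H _ _ t => isDP_responseKernel nbr hε t) ih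

theorem profileAttains_one_br (nbr : 𝒳 → 𝒳 → Prop) {ε : ℝ} (hε : 0 < ε) {hi : ℝ}
    (hhi : hi ∈ Set.Icc 1 (Real.exp ε)) (i m : ℕ) :
    ProfileAttains.{u, v} b (List.replicate i (classDP nbr ε) ++
        classBR nbr ε :: List.replicate m (classDP nbr ε))
      ((dpStep (Real.exp ε))^[i + m] (chord (hi / Real.exp ε) hi hockey)) := by
  have hc := Real.one_lt_exp_iff.2 hε
  have hc0 := Real.exp_pos ε
  have hi0 : 0 < hi := by linarith [hhi.1]
  -- Commutation puts the BR operator at position i, matching the list of classes.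
  rw [Function.iterate_add_apply, ((chord_commute _ _ _ _).iterate_left m).eq]
  refine profileAttains_replicate_append nbr hε (profileAttains_cons (by positivity)
    (div_lt_self_of_mem hc hhi) (div_le_one_of_mem hc hhi) hhi.1
    (fun H _ _ t => isBR_responseKernel nbr hε hhi t) ?_) i
  have := profileAttains_replicate_append nbr hε (profileAttains_nil (b := b)) m
  rwa [List.append_nil] at this

end Lower

/-! ### Comparison of adaptive classes -/

section Optimal

variable {𝒳 : Type u} {nbr : 𝒳 → 𝒳 → Prop}

theorem isDP_one {Y : Type v} [MeasurableSpace Y] (M : Mechanism 𝒳 Y) (εg : ℝ) :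
    IsDP nbr M εg 1 := by
  intro x x' _ S _
  have h1 : (M x S : ℝ) ≤ 1 := by exact_mod_cast (M x).apply_le_one S
  have h2 : 0 ≤ Real.exp εg * (M x' S : ℝ) := by positivity
  linarith

theorem deltaOptMech_nonneg {Y : Type v} [MeasurableSpace Y] (M : Mechanism 𝒳 Y) (εg : ℝ) :
    0 ≤ deltaOptMech nbr M εg :=
  Real.sInf_nonneg fun _ h => h.1

theorem deltaOptMech_le {Y : Type v} [MeasurableSpace Y] {M : Mechanism 𝒳 Y} {εg δ : ℝ}
    (h0 : 0 ≤ δ) (h : IsDP nbr M εg δ) : deltaOptMech nbr M εg ≤ δ :=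
  csInf_le ⟨0, fun _ h => h.1⟩ ⟨h0, h⟩

theorem sub_le_deltaOptMech {Y : Type v} [MeasurableSpace Y] (M : Mechanism 𝒳 Y) (εg : ℝ)
    {x x' : 𝒳} (hx : nbr x x') {S : Set Y} (hS : MeasurableSet S) :
    (M x S : ℝ) - Real.exp εg * (M x' S : ℝ) ≤ deltaOptMech nbr M εg := by
  refine le_csInf ⟨1, zero_le_one, isDP_one M εg⟩ fun δ hδ => ?_
  linarith [hδ.2 x x' hx S hS]

theorem deltaOptMech_le_deltaOpt {C : MechClass.{u, v} 𝒳} {Y : Type v} [MeasurableSpace Y]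
    {M : Mechanism 𝒳 Y} (hM : M ∈ C Y) (εg : ℝ) :
    deltaOptMech nbr M εg ≤ deltaOpt nbr C εg := by
  refine le_csSup ⟨1, ?_⟩ ⟨Y, _, M, hM, rfl⟩
  rintro _ ⟨Y, _, M, _, rfl⟩
  exact deltaOptMech_le zero_le_one (isDP_one M εg)

theorem deltaOpt_nonneg (C : MechClass.{u, v} 𝒳) (εg : ℝ) : 0 ≤ deltaOpt nbr C εg := by
  refine Real.sSup_nonneg ?_
  rintro _ ⟨Y, _, M, _, rfl⟩
  exact deltaOptMech_nonneg M εg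

theorem IsAdaptiveRun.sub_le_deltaOpt {Cs : List (MechClass.{u, v} 𝒳)} {R : Type v}
    [MeasurableSpace R] {κ : 𝒳 → Kernel PUnit.{v + 1} R}
    (h : IsAdaptiveRun Cs PUnit.{v + 1} R κ) (εg : ℝ) {x x' : 𝒳} (hx : nbr x x') {S : Set R}
    (hS : MeasurableSet S) :
    (κ x PUnit.unit).real S - Real.exp εg * (κ x' PUnit.unit).real S ≤
      deltaOpt nbr (adaptiveClass Cs) εg := by
  have := h.isMarkovKernel
  have hM : mechAt κ PUnit.unit ∈ adaptiveClass Cs R := ⟨κ, h, fun _ => rfl⟩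
  exact (sub_le_deltaOptMech _ εg hx hS).trans (deltaOptMech_le_deltaOpt hM εg)

/-- Each neighbouring pair and run of the first composition is matched by a run of the second built
for that pair; equality later follows by symmetry. -/
theorem deltaOpt_one_br_le (hnbr : ∀ x x', nbr x x' → nbr x' x) {ε : ℝ} (hε : 0 < ε)
    {i m i' m' : ℕ} (hlen : i + m = i' + m') (εg : ℝ) :
    deltaOpt nbr (adaptiveClass.{u, v} (List.replicate i (classDP nbr ε) ++
        classBR nbr ε :: List.replicate m (classDP nbr ε))) εg ≤
      deltaOpt nbr (adaptiveClass.{u, v} (List.replicate i' (classDP nbr ε) ++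
        classBR nbr ε :: List.replicate m' (classDP nbr ε))) εg := by
  classical
  set Cs : List (MechClass.{u, v} 𝒳) := List.replicate i' (classDP nbr ε) ++
    classBR nbr ε :: List.replicate m' (classDP nbr ε) with hCs
  refine Real.sSup_le ?_ (deltaOpt_nonneg _ εg)
  rintro _ ⟨Y, _, M, ⟨κ, hκ, hM⟩, rfl⟩
  refine deltaOptMech_le (deltaOpt_nonneg _ εg) fun x x' hx S hS => ?_
  -- Multiplying the profile at this r by exp εg gives the DP defect.
  have hr : 0 < (Real.exp εg)⁻¹ := by positivity
  obtain ⟨hi, hhi, hle⟩ := hκ.exists_le_chord hnbr hε hx hr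
  -- Only x is marked, so the randomized responses separate x from every other dataset.
  obtain ⟨R, _, κ', hκ', hval⟩ := profileAttains_one_br (b := fun z => decide (z = x)) nbr hε hhi
    i' m' PUnit.{v + 1}
  have hmarkov := hκ'.isMarkovKernel
  have e : ∀ z, (M z S : ℝ) = (κ z PUnit.unit).real S := fun z => by
    rw [← hM z]; rfl
  rw [e, e]
  -- The relation may be reflexive, and marking cannot separate x from itself. Then the defect p(1 -
  -- exp εg), with p in [0, 1], is at most max(0, 1 - exp εg), which the whole space as event and
  -- nonnegativity already provide.
  by_cases hxx : x' = x
  · subst hxx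
    have h1 := hκ'.sub_le_deltaOpt εg hx MeasurableSet.univ
    have h2 := deltaOpt_nonneg (nbr := nbr) (adaptiveClass Cs) εg
    have := hκ.isMarkovKernel x'
    have p0 : 0 ≤ (κ x' PUnit.unit).real S := measureReal_nonneg
    have p1 : (κ x' PUnit.unit).real S ≤ 1 := measureReal_le_one
    simp only [probReal_univ, mul_one] at h1
    rw [← hCs] at h1
    nlinarith
  · obtain ⟨T, hT, hT'⟩ := hval x x' (by simp) (by simpa using hxx) _ hr PUnit.unit
    have h1 := hκ'.sub_le_deltaOpt εg hx hT
    have h2 := hle PUnit.unit S hS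
    rw [hlen] at h2
    have h3 := mul_le_mul_of_nonneg_left (h2.trans hT') (Real.exp_pos εg).le
    rw [mul_sub, mul_sub, mul_inv_cancel_left₀ (Real.exp_pos εg).ne',
      mul_inv_cancel_left₀ (Real.exp_pos εg).ne'] at h3
    linarith

end Optimal

theorem List.ofFn_eq_replicate_append_cons {α : Type*} {N : ℕ} {f : Fin N → α} {k : Fin N}
    {a d : α} (hk : f k = a) (h : ∀ i, i ≠ k → f i = d) :
    List.ofFn f = List.replicate k d ++ a :: List.replicate (N - 1 - k) d := by
  refine List.ext_getElem (by simp; omega) fun n h1 h2 => ?_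
  rw [List.getElem_ofFn]
  have hn : n < N := by simpa using h1
  rcases lt_trichotomy n k with hlt | heq | hlt
  · rw [List.getElem_append_left (by simpa using hlt), List.getElem_replicate]
    exact h _ (by simp [Fin.ext_iff]; omega)
  · subst heq
    rw [List.getElem_append_right (by simp)]
    simpa using hk
  · rw [List.getElem_append_right (by simp; omega), List.getElem_cons, dif_neg (by simp; omega),
      List.getElem_replicate]
    exact h _ (by simp [Fin.ext_iff]; omega)

theorem mainTheorem5 {𝒳 : Type u} (nbr : 𝒳 → 𝒳 → Prop) (hnbr : ∀ x x', nbr x x' → nbr x' x)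
    (ε : ℝ) (hε : 0 < ε) (N : ℕ) (A B : Fin N → MechClass.{u, v} 𝒳) (kA kB : Fin N)
    (hA : A kA = classBR nbr ε) (hA' : ∀ i, i ≠ kA → A i = classDP nbr ε)
    (hB : B kB = classBR nbr ε) (hB' : ∀ j, j ≠ kB → B j = classDP nbr ε) (εg : ℝ) :
    deltaOpt nbr (adaptiveClass (List.ofFn A)) εg =
      deltaOpt nbr (adaptiveClass (List.ofFn B)) εg := by
  rw [List.ofFn_eq_replicate_append_cons hA hA', List.ofFn_eq_replicate_append_cons hB hB']
  have hlen : (kA : ℕ) + (N - 1 - kA) = kB + (N - 1 - kB) := by omega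
  exact le_antisymm (deltaOpt_one_br_le hnbr hε hlen εg)
    (deltaOpt_one_br_le hnbr hε hlen.symm εg)
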